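/- For complex parameters and $(q)_n=q(q+1)\cdots(q+n-1)$, $(q)_0=1$, let $${}_2F_1\!\left(\begin{matrix}a,b\\ d\end{matrix};z\right)=\sum_{n\ge0}\frac{(a)_n(b)_n}{(d)_n}\frac{z^n}{n!},\qquad {}_3F_2\!\left(\begin{matrix}a,b,c\\ d,e\end{matrix};z\right)=\sum_{n\ge0}\frac{(a)_n(b)_n(c)_n}{(d)_n(e)_n}\frac{z^n}{n!},$$ where a series one of whose numerator parameters is a non-positive integer $-m$ is terminated after the term $n=m$. Let $\sqrt{\cdot}$ be the principal square root and let $k_1\ge k_2\ge 1$ be integers. 1. For every $x\in\mathbb C$ with $0<|x|<1$ the power series on the left converges and $${}_3F_2\!\left(\begin{matrix}1,\frac{k_1+k_2}{2}+1,\frac{k_1+k_2+1}{2}\\ k_1+1,k_2+1\end{matrix};x\right)=\frac{k_1!\,k_2!}{(k_1+k_2)!}\,\frac{2^{k_1+k_2}}{x^{k_2}}\,\frac{(1+\sqrt{1-x})^{k_2-k_1}}{\sqrt{1-x}}-\frac{4k_1k_2}{(k_1+k_2-1)(k_1+k_2)\,x}\;{}_3F_2\!\left(\begin{matrix}1,1-k_2,1-k_1\\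 \frac{-k_1-k_2}{2}+1,\frac{-k_1-k_2+3}{2}\end{matrix};\frac1x\right).$$ 2. For every $x\in\mathbb C$, $x\ne1$, with $\left|\frac12-\frac12\sqrt{1-x}\right|<1$ and $\left|\frac12+\frac12\sqrt{1-x}\right|<1$ (in particular for every real $0<x<1$), the two ${}_2F_1$ series below converge and $${}_3F_2\!\left(\begin{matrix}1,1-k_2,1-k_1\\ \frac{-k_1-k_2}{2}+1,\frac{-k_1-k_2+3}{2}\end{matrix};\frac1x\right)=-\frac{k_1+k_2-1}{4k_1}\,\frac{x}{\sqrt{1-x}}\left[{}_2F_1\!\left(\begin{matrix}1,k_1+k_2\\ k_1+1\end{matrix};\tfrac12-\tfrac12\sqrt{1-x}\right)-{}_2F_1\!\left(\begin{matrix}1,k_1+k_2\\ k_1+1\end{matrix};\tfrac12+\tfrac12\sqrt{1-x}\right)\right].$$ (The ${}_3F_2$ in $1/x$ ends with the term $n=k_2-1$, and since $k_1\ge k_2\ge1$ its denominators do not vanish up to there, so it is a well-defined polynomial in $1/x$.) -/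

import Mathlib

/-- The `n`-th term `(a)_n (b)_n (c)_n / ((d)_n (e)_n) * z ^ n / n!` of the hypergeometric series
`₃F₂(a, b, c; d, e; z)`, where `(q)_n = q (q + 1) ⋯ (q + n - 1)` is the rising factorial.
If a numerator parameter is a non-positive integer `-m`, all terms with `n > m` are `0`, also those
in which a denominator factor vanishes too: the series stops where its numerator vanishes. -/
noncomputable def hypergeometric3F2Term (a b c d e z : ℂ) (n : ℕ) : ℂ :=
  ((ascPochhammer ℂ n).eval a * (ascPochhammer ℂ n).eval b * (ascPochhammer ℂ n).eval c) /
    ((ascPochhammer ℂ n).eval d * (ascPochhammer ℂ n).eval e) * (z ^ n / (n.factorial : ℂ))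

/-- The hypergeometric function `₃F₂(a, b, c; d, e; z)`, the sum of its power series. -/
noncomputable def hypergeometric3F2 (a b c d e z : ℂ) : ℂ :=
  ∑' n : ℕ, hypergeometric3F2Term a b c d e z n

open Finset

/-- The Horner-type sum `∑ j ≤ l, c (l - j) * w ^ j`. -/
noncomputable def revPowerSum (c : ℕ → ℂ) (w : ℂ) (l : ℕ) : ℂ :=
  ∑ j ∈ range (l + 1), c (l - j) * w ^ j

lemma revPowerSum_zero (c : ℕ → ℂ) (w : ℂ) : revPowerSum c w 0 = c 0 := by
  simp [revPowerSum]

lemma revPowerSum_succ (c : ℕ → ℂ) (w : ℂ) (l : ℕ) :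
    revPowerSum c w (l + 1) = c (l + 1) + w * revPowerSum c w l := by
  rw [revPowerSum, sum_range_succ', revPowerSum, mul_sum, add_comm]
  congr 1
  · simp
  · refine sum_congr rfl fun j _ => ?_
    rw [Nat.add_sub_add_right, pow_succ]
    ring

/-- The coefficients of `(1 - w) ^ (-(m + 1))`. -/
def diagonalChoose (m i : ℕ) : ℂ := ((m + i).choose i : ℂ)

lemma diagonalChoose_zero (m : ℕ) : diagonalChoose m 0 = 1 := by simp [diagonalChoose]

lemma diagonalChoose_succ_succ (m i : ℕ) :
    diagonalChoose (m + 1) (i + 1) = diagonalChoose m (i + 1) + diagonalChoose (m + 1) i := by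
  simp only [diagonalChoose]
  rw [show m + 1 + (i + 1) = (m + 1 + i) + 1 by ring, Nat.choose_succ_succ,
    show m + (i + 1) = m + 1 + i by ring]
  push_cast
  ring

lemma sub_one_mul_revPowerSum_diagonalChoose (w : ℂ) (m l : ℕ) :
    (w - 1) * revPowerSum (diagonalChoose (m + 1)) w l =
      w * revPowerSum (diagonalChoose m) w l - diagonalChoose (m + 1) l := by
  induction l with
  | zero => simp [revPowerSum_zero, diagonalChoose_zero]
  | succ l ih =>
    rw [revPowerSum_succ, revPowerSum_succ, diagonalChoose_succ_succ]
    linear_combination w * ih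

lemma revPowerSum_diagonalChoose_sub {a b : ℂ} (hab : a * b = a + b) (d l : ℕ) :
    a * revPowerSum (diagonalChoose (l + d)) a l - b * revPowerSum (diagonalChoose (l + d)) b l =
      (a - b) * revPowerSum (fun i => ((2 * i + d).choose i : ℂ)) (a * b) l := by
  induction l with
  | zero => simp [revPowerSum_zero, diagonalChoose_zero]
  | succ l ih =>
    have ha := sub_one_mul_revPowerSum_diagonalChoose a (l + d) l
    have hb := sub_one_mul_revPowerSum_diagonalChoose b (l + d) l
    have hc : (((2 * (l + 1) + d).choose (l + 1) : ℕ) : ℂ) =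
        diagonalChoose (l + d + 1) (l + 1) := by
      rw [diagonalChoose, show 2 * (l + 1) + d = l + d + 1 + (l + 1) by ring]
    rw [show l + 1 + d = l + d + 1 by ring, revPowerSum_succ, revPowerSum_succ, revPowerSum_succ, hc]
    generalize diagonalChoose (l + d + 1) (l + 1) = C at *
    generalize diagonalChoose (l + d + 1) l = C' at *
    generalize revPowerSum (diagonalChoose (l + d)) a l = A at *
    generalize revPowerSum (diagonalChoose (l + d)) b l = B at *
    generalize revPowerSum (diagonalChoose (l + d + 1)) a l = A' at *
    generalize revPowerSum (diagonalChoose (l + d + 1)) b l = B' at *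
    generalize revPowerSum _ (a * b) l = P at *
    linear_combination a * b * ih + a * b * ha - a * b * hb -
      (a * A' - b * B') * hab

lemma summable_choose_add_mul_geometric {u : ℂ} (hu : ‖u‖ < 1) (n l : ℕ) :
    Summable fun j : ℕ => ((n + l + j).choose l : ℂ) * u ^ j := by
  rcases eq_or_ne u 0 with rfl | h0
  · refine summable_of_ne_finset_zero (s := {0}) fun j hj => ?_
    simp [zero_pow (by simpa using hj : j ≠ 0)]
  · have h : Summable fun j : ℕ => (u ^ n)⁻¹ * (((j + n + l).choose l : ℂ) * u ^ (j + n)) :=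
      ((summable_nat_add_iff (f := fun j : ℕ => ((j + l).choose l : ℂ) * u ^ j) n).2
        (summable_choose_mul_geometric_of_norm_lt_one l hu)).mul_left _
    refine h.congr fun j => ?_
    rw [show j + n + l = n + l + j by ring, pow_add]
    field_simp

/-- Euler's transformation of `₂F₁(1, m + l + 2; m + 2; u)` in binomial form. -/
lemma hasSum_choose_add_mul_geometric {u : ℂ} (hu : ‖u‖ < 1) (m l : ℕ) :
    HasSum (fun j : ℕ => ((m + 1 + l + j).choose l : ℂ) * u ^ j)
      ((1 - u)⁻¹ * revPowerSum (diagonalChoose m) (1 - u)⁻¹ l) := by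
  have hu1 : 1 - u ≠ 0 := by
    rintro h
    rw [← sub_eq_zero.1 h] at hu
    simp at hu
  induction l with
  | zero => simpa [revPowerSum_zero, diagonalChoose_zero] using hasSum_geometric_of_norm_lt_one hu
  | succ l ih =>
    obtain ⟨S, hS⟩ := summable_choose_add_mul_geometric hu (m + 1) (l + 1)
    have h1 := (hasSum_nat_add_iff' 1).2 hS
    have h2 := ((hasSum_nat_add_iff' 1).2 ih).add (hS.mul_left u)
    have h3 := h1.unique (h2.congr_fun fun j => ?_)
    · convert hS using 1
      have hc : (((m + 1 + (l + 1)).choose (l + 1) : ℕ) : ℂ) =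
          (m + 1 + l).choose l + diagonalChoose m (l + 1) := by
        rw [diagonalChoose, show m + 1 + (l + 1) = (m + 1 + l) + 1 by ring, Nat.choose_succ_succ,
          show m + (l + 1) = m + 1 + l by ring]
        push_cast
        ring
      simp only [range_one, sum_singleton, add_zero, pow_zero, mul_one, hc] at h3
      rw [revPowerSum_succ]
      field_simp
      field_simp at h3
      linear_combination -h3
    · rw [show m + 1 + (l + 1) + (j + 1) = (m + 1 + l + (j + 1)) + 1 by ring, Nat.choose_succ_succ,
        show m + 1 + (l + 1) + j = m + 1 + l + (j + 1) by ring, pow_succ]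
      push_cast
      ring

lemma ascPochhammer_eval_duplication (a : ℂ) (n : ℕ) :
    (ascPochhammer ℂ n).eval a * (ascPochhammer ℂ n).eval (a + 1 / 2) * 4 ^ n =
      (ascPochhammer ℂ (2 * n)).eval (2 * a) := by
  induction n with
  | zero => simp
  | succ n ih =>
    rw [show 2 * (n + 1) = 2 * n + 1 + 1 by ring]
    simp only [ascPochhammer_succ_eval]
    rw [← ih]
    push_cast
    ring

lemma factorial_mul_ascPochhammer_eval (r n : ℕ) :
    (r.factorial : ℂ) * (ascPochhammer ℂ n).eval ((r : ℂ) + 1) = ((r + n).factorial : ℂ) :=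
  factorial_mul_ascPochhammer ℂ r n

lemma factorial_mul_ascPochhammer_eval_neg (i j : ℕ) :
    (i.factorial : ℂ) * (ascPochhammer ℂ j).eval (-((i + j : ℕ) : ℂ)) =
      (-1) ^ j * ((i + j).factorial : ℂ) := by
  rw [ascPochhammer_eval_neg_eq_descPochhammer, descPochhammer_eval_eq_descFactorial,
    ← Nat.factorial_mul_descFactorial (Nat.le_add_left j i)]
  simp
  ring

lemma four_pow_mul_choose_half (n : ℕ) :
    (4 : ℂ) ^ n * Ring.choose ((1 / 2 : ℂ) + n - 1) n = ((2 * n).choose n : ℂ) := by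
  have h : Ring.choose ((1 / 2 : ℂ) + n - 1) n =
      (n.factorial : ℂ)⁻¹ * (ascPochhammer ℂ n).eval (1 / 2) := by
    simp only [Ring.choose_eq_smul, Polynomial.descPochhammer_smeval_eq_ascPochhammer,
      Polynomial.ascPochhammer_smeval_cast, Polynomial.ascPochhammer_smeval_eq_eval]
    rw [smul_eq_mul]
    congr 2
    ring
  have h2 := ascPochhammer_eval_duplication (1 / 2) n
  have h3 : (ascPochhammer ℂ n).eval ((1 / 2 : ℂ) + 1 / 2) = n.factorial := by
    rw [show (1 / 2 : ℂ) + 1 / 2 = 1 by norm_num, ascPochhammer_eval_one]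
  have h4 : (ascPochhammer ℂ (2 * n)).eval (2 * (1 / 2 : ℂ)) = (2 * n).factorial := by
    rw [show (2 : ℂ) * (1 / 2) = 1 by norm_num, ascPochhammer_eval_one]
  have h5 : ((2 * n).choose n : ℂ) * n.factorial * n.factorial = (2 * n).factorial := by
    have := Nat.choose_mul_factorial_mul_factorial (show n ≤ 2 * n by omega)
    rw [show 2 * n - n = n by omega] at this
    exact_mod_cast this
  have hn : (n.factorial : ℂ) ≠ 0 := by exact_mod_cast n.factorial_ne_zero
  rw [h3, h4, ← h5] at h2
  rw [h]
  apply mul_right_cancel₀ hn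
  apply mul_right_cancel₀ hn
  rw [← h2]
  field_simp

lemma Complex.sqrt_mul_self (z : ℂ) : Complex.sqrt z * Complex.sqrt z = z := by
  have := Complex.cpow_nat_inv_pow z two_ne_zero
  rw [pow_two] at this
  simpa [Complex.sqrt] using this

lemma hasSum_centralBinom_mul_pow {x : ℂ} (hx : ‖x‖ < 1) :
    HasSum (fun n : ℕ => ((2 * n).choose n : ℂ) * (x / 4) ^ n) (Complex.sqrt (1 - x))⁻¹ := by
  have h := (Complex.one_div_one_sub_cpow_hasFPowerSeriesOnBall_zero (1 / 2)).hasSum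
    (y := x) (by simpa [enorm_eq_nnnorm, ← NNReal.coe_lt_coe] using hx)
  rw [zero_add] at h
  have hv : (Complex.sqrt (1 - x))⁻¹ = 1 / (1 - x) ^ (1 / 2 : ℂ) := by simp [Complex.sqrt]
  rw [hv]
  exact h.congr_fun fun n => by
    rw [FormalMultilinearSeries.ofScalars_apply_eq, ← four_pow_mul_choose_half, div_pow,
      smul_eq_mul]
    field_simp

lemma Nat.choose_two_mul_add_succ (d m : ℕ) :
    (2 * (m + 1) + (d + 1)).choose (m + 1) =
      (2 * (m + 1) + d).choose (m + 1) + (2 * m + (d + 2)).choose m := by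
  rw [show 2 * (m + 1) + (d + 1) = (2 * (m + 1) + d) + 1 by ring, Nat.choose_succ_succ,
    show 2 * m + (d + 2) = 2 * (m + 1) + d by ring, add_comm]

lemma Nat.choose_two_mul_succ (m : ℕ) :
    (2 * (m + 1)).choose (m + 1) = 2 * (2 * m + 1).choose m := by
  rw [show 2 * (m + 1) = (2 * m + 1) + 1 by ring, Nat.choose_succ_succ,
    Nat.choose_symm_half]
  ring

/-- The generating function of the binomial coefficients `(2 m + d).choose m`. -/
lemma hasSum_choose_two_mul_add_mul_pow {x : ℂ} (h0 : x ≠ 0) (hx : ‖x‖ < 1) (d : ℕ) :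
    HasSum (fun m : ℕ => ((2 * m + d).choose m : ℂ) * (x / 4) ^ m)
      ((2 / (1 + Complex.sqrt (1 - x))) ^ d / Complex.sqrt (1 - x)) := by
  have hs := Complex.sqrt_mul_self (1 - x)
  have hx1 : 1 - x ≠ 0 := by
    rintro h
    rw [← sub_eq_zero.1 h] at hx
    simp at hx
  have hc := hasSum_centralBinom_mul_pow hx
  set s := Complex.sqrt (1 - x)
  have hs0 : s ≠ 0 := by
    rintro h
    rw [h, mul_zero] at hs
    exact hx1 hs.symm
  have hs1 : 1 + s ≠ 0 := by
    rintro h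
    apply h0
    linear_combination (1 - s) * h + hs
  have hs2 : 1 - s ≠ 0 := by
    rintro h
    apply h0
    linear_combination (1 + s) * h + hs
  have hxs : x = (1 - s) * (1 + s) := by linear_combination hs
  induction d using Nat.twoStepInduction with
  | zero => simpa using hc
  | one =>
    have h := ((hasSum_nat_add_iff' 1).2 hc).mul_left (2 / x)
    have hv : (2 / (1 + s)) ^ 1 / s =
        2 / x * (s⁻¹ - ∑ i ∈ range 1, ((2 * i).choose i : ℂ) * (x / 4) ^ i) := by
      rw [hxs]
      simp only [range_one, sum_singleton, mul_zero, Nat.choose_self, Nat.cast_one, pow_zero]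
      field_simp
    rw [hv]
    refine h.congr_fun fun m => ?_
    rw [Nat.choose_two_mul_succ, pow_succ]
    push_cast
    field_simp
    ring
  | more d h1 h2 =>
    have h := ((hasSum_nat_add_iff' 1).2 (h2.sub h1)).mul_left (4 / x)
    have hv : (2 / (1 + s)) ^ (d + 2) / s =
        4 / x * ((2 / (1 + s)) ^ (d + 1) / s - (2 / (1 + s)) ^ d / s -
          ∑ i ∈ range 1, (((2 * i + (d + 1)).choose i : ℂ) * (x / 4) ^ i -
            ((2 * i + d).choose i : ℂ) * (x / 4) ^ i)) := by
      rw [hxs]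
      simp only [range_one, sum_singleton, Nat.choose_zero_right, Nat.cast_one, pow_zero, pow_succ]
      field_simp
      ring
    rw [hv]
    refine h.congr_fun fun m => ?_
    rw [Nat.choose_two_mul_add_succ, pow_succ]
    push_cast
    field_simp
    ring

lemma Nat.cast_choose_mul_factorial (i j : ℕ) :
    ((i + j).choose i : ℂ) * i.factorial * j.factorial = (i + j).factorial := by
  rw [Nat.choose_symm_add]
  exact_mod_cast Nat.add_choose_mul_factorial_mul_factorial i j

lemma hypergeometric3F2Term_eq_choose (l d n : ℕ) (k₁ k₂ : ℂ) (x : ℂ)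
    (h₁ : k₁ = ((l + d : ℕ) : ℂ)) (h₂ : k₂ = l) :
    hypergeometric3F2Term 1 ((k₁ + k₂) / 2 + 1) ((k₁ + k₂ + 1) / 2) (k₁ + 1) (k₂ + 1) x n =
      ((l + d).factorial : ℂ) * l.factorial / (l + d + l).factorial *
        (((2 * (n + l) + d).choose (n + l) : ℂ) * (x / 4) ^ n) := by
  have hK : k₁ + k₂ = ((l + d + l : ℕ) : ℂ) := by rw [h₁, h₂]; push_cast; ring
  have hd := ascPochhammer_eval_duplication ((k₁ + k₂ + 1) / 2) n
  rw [show (k₁ + k₂ + 1) / 2 + 1 / 2 = (k₁ + k₂) / 2 + 1 by ring,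
    show 2 * ((k₁ + k₂ + 1) / 2) = (k₁ + k₂) + 1 by ring, hK] at hd
  have e0 := factorial_mul_ascPochhammer_eval (l + d + l) (2 * n)
  have e1 := factorial_mul_ascPochhammer_eval (l + d) n
  have e2 := factorial_mul_ascPochhammer_eval l n
  have e3 := Nat.cast_choose_mul_factorial (n + l) (l + d + n)
  rw [show n + l + (l + d + n) = 2 * (n + l) + d by ring] at e3
  rw [show l + d + l + 2 * n = 2 * (n + l) + d by ring, ← hd, ← e3, ← e1,
    show n + l = l + n by ring, ← e2] at e0
  have f0 : ((l + d + l).factorial : ℂ) ≠ 0 := by exact_mod_cast Nat.factorial_ne_zero _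
  have fn : (n.factorial : ℂ) ≠ 0 := by exact_mod_cast Nat.factorial_ne_zero _
  have g1 : (ascPochhammer ℂ n).eval (((l + d : ℕ) : ℂ) + 1) ≠ 0 := by
    rintro h
    rw [h, mul_zero] at e1
    exact (Nat.factorial_ne_zero (l + d + n)) (by exact_mod_cast e1.symm)
  have g2 : (ascPochhammer ℂ n).eval ((l : ℂ) + 1) ≠ 0 := by
    rintro h
    rw [h, mul_zero] at e2
    exact (Nat.factorial_ne_zero (l + n)) (by exact_mod_cast e2.symm)
  rw [hypergeometric3F2Term, ascPochhammer_eval_one, hK, h₁, h₂, div_pow,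
    show n + l = l + n by ring]
  generalize (ascPochhammer ℂ n).eval (((l + d + l : ℕ) : ℂ) / 2 + 1) = A at *
  generalize (ascPochhammer ℂ n).eval ((((l + d + l : ℕ) : ℂ) + 1) / 2) = B at *
  field_simp
  linear_combination x ^ n * e0

lemma hypergeometric3F2_terminating (l d : ℕ) (k₁ k₂ : ℂ) (z : ℂ)
    (h₁ : k₁ = ((l + d + 1 : ℕ) : ℂ)) (h₂ : k₂ = ((l + 1 : ℕ) : ℂ)) :
    ((2 * l + d).choose l : ℂ) *
      hypergeometric3F2 1 (-k₂ + 1) (-k₁ + 1) ((-k₁ - k₂) / 2 + 1) ((-k₁ - k₂ + 3) / 2) z =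
      revPowerSum (fun i => ((2 * i + d).choose i : ℂ)) (4 * z) l := by
  have p₁ : -k₁ + 1 = -((l + d : ℕ) : ℂ) := by rw [h₁]; push_cast; ring
  have p₂ : -k₂ + 1 = -((l : ℕ) : ℂ) := by rw [h₂]; push_cast; ring
  rw [hypergeometric3F2, tsum_eq_sum (s := range (l + 1)), revPowerSum, mul_sum]
  · refine sum_congr rfl fun j hj => ?_
    obtain ⟨i, rfl⟩ : ∃ i, l = i + j := ⟨l - j, by have := mem_range.1 hj; omega⟩
    have hd := ascPochhammer_eval_duplication ((-k₁ - k₂) / 2 + 1) j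
    rw [show (-k₁ - k₂) / 2 + 1 + 1 / 2 = (-k₁ - k₂ + 3) / 2 by ring,
      show 2 * ((-k₁ - k₂) / 2 + 1) = (-k₁ + 1) + (-k₂ + 1) by ring, p₁, p₂,
      show -((i + j + d : ℕ) : ℂ) + -((i + j : ℕ) : ℂ) = -((2 * i + d + 2 * j : ℕ) : ℂ) by
        push_cast; ring] at hd
    have e0 := factorial_mul_ascPochhammer_eval_neg (2 * i + d) (2 * j)
    have e1 := factorial_mul_ascPochhammer_eval_neg (i + d) j
    have e2 := factorial_mul_ascPochhammer_eval_neg i j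
    have e3 := Nat.cast_choose_mul_factorial (i + j) (i + d + j)
    have e4 := Nat.cast_choose_mul_factorial i (i + d)
    rw [pow_mul, neg_one_sq, one_pow, one_mul, ← hd] at e0
    rw [show i + j + (i + d + j) = 2 * i + d + 2 * j by ring] at e3
    rw [show i + (i + d) = 2 * i + d by ring] at e4
    have f0 : ((2 * i + d + 2 * j).factorial : ℂ) ≠ 0 := by exact_mod_cast Nat.factorial_ne_zero _
    have f1 : ((i + d).factorial : ℂ) ≠ 0 := by exact_mod_cast Nat.factorial_ne_zero _
    have f2 : (i.factorial : ℂ) ≠ 0 := by exact_mod_cast Nat.factorial_ne_zero _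
    have fj : (j.factorial : ℂ) ≠ 0 := by exact_mod_cast Nat.factorial_ne_zero _
    have g1 : (ascPochhammer ℂ j).eval ((-k₁ - k₂) / 2 + 1) ≠ 0 := by
      rintro h
      rw [h] at e0
      exact f0 (by simpa using e0.symm)
    have g2 : (ascPochhammer ℂ j).eval ((-k₁ - k₂ + 3) / 2) ≠ 0 := by
      rintro h
      rw [h] at e0
      exact f0 (by simpa using e0.symm)
    rw [hypergeometric3F2Term, ascPochhammer_eval_one, p₁, p₂, Nat.add_sub_cancel,
      show 2 * (i + j) + d = 2 * i + d + 2 * j by ring, show i + j + d = i + d + j by ring, mul_pow]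
    generalize (ascPochhammer ℂ j).eval ((-k₁ - k₂) / 2 + 1) = D at *
    generalize (ascPochhammer ℂ j).eval ((-k₁ - k₂ + 3) / 2) = E at *
    field_simp
    apply mul_right_cancel₀ f1
    apply mul_right_cancel₀ f2
    have hm : ((-1 : ℂ) ^ j) * (-1) ^ j = 1 := by rw [← mul_pow]; simp
    rw [← e4] at e0
    rw [← e3] at e0
    set A := (ascPochhammer ℂ j).eval (-((i + d + j : ℕ) : ℂ))
    set B := (ascPochhammer ℂ j).eval (-((i + j : ℕ) : ℂ))
    linear_combination z ^ j * (((2 * i + d + 2 * j).choose (i + j) : ℂ) * i.factorial * B * e1 +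
      ((2 * i + d + 2 * j).choose (i + j) : ℂ) * (-1) ^ j * (i + d + j).factorial * e2 +
      ((2 * i + d + 2 * j).choose (i + j) : ℂ) * (i + j).factorial * (i + d + j).factorial * hm
      - e0)
  · intro n hn
    rw [hypergeometric3F2Term, p₂, ascPochhammer_eval_neg_coe_nat_of_lt
      (by simpa using hn : l < n)]
    simp

lemma ordinaryHypergeometricCoefficient_eq_choose (m l j : ℕ) (k₁ k₂ : ℂ)
    (h₁ : k₁ = ((m + 1 : ℕ) : ℂ)) (h₂ : k₂ = ((l + 1 : ℕ) : ℂ)) :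
    ordinaryHypergeometricCoefficient 1 (k₁ + k₂) (k₁ + 1) j =
      ((m + 1).factorial : ℂ) * l.factorial / (m + 1 + l).factorial *
        ((m + 1 + l + j).choose l : ℂ) := by
  have e0 := factorial_mul_ascPochhammer_eval (m + 1 + l) j
  have e1 := factorial_mul_ascPochhammer_eval (m + 1) j
  have e3 := Nat.cast_choose_mul_factorial l (m + 1 + j)
  rw [show l + (m + 1 + j) = m + 1 + l + j by ring, ← e0, ← e1] at e3
  have f0 : ((m + 1 + l).factorial : ℂ) ≠ 0 := by exact_mod_cast Nat.factorial_ne_zero _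
  have fj : (j.factorial : ℂ) ≠ 0 := by exact_mod_cast Nat.factorial_ne_zero _
  have g1 : (ascPochhammer ℂ j).eval (((m + 1 : ℕ) : ℂ) + 1) ≠ 0 := by
    rintro h
    rw [h, mul_zero] at e1
    exact (Nat.factorial_ne_zero (m + 1 + j)) (by exact_mod_cast e1.symm)
  rw [ordinaryHypergeometricCoefficient, ascPochhammer_eval_one, h₁, h₂,
    show ((m + 1 : ℕ) : ℂ) + ((l + 1 : ℕ) : ℂ) = ((m + 1 + l : ℕ) : ℂ) + 1 by push_cast; ring]
  field_simp
  linear_combination -e3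

lemma hasSum_ordinaryHypergeometric_one {u : ℂ} (hu : ‖u‖ < 1) (m l : ℕ) (k₁ k₂ : ℂ)
    (h₁ : k₁ = ((m + 1 : ℕ) : ℂ)) (h₂ : k₂ = ((l + 1 : ℕ) : ℂ)) :
    HasSum (fun n : ℕ => ordinaryHypergeometricCoefficient 1 (k₁ + k₂) (k₁ + 1) n * u ^ n)
      (((m + 1).factorial : ℂ) * l.factorial / (m + 1 + l).factorial *
        ((1 - u)⁻¹ * revPowerSum (diagonalChoose m) (1 - u)⁻¹ l)) := by
  refine ((hasSum_choose_add_mul_geometric hu m l).mul_left _).congr_fun fun n => ?_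
  rw [ordinaryHypergeometricCoefficient_eq_choose m l n k₁ k₂ h₁ h₂, mul_assoc]

lemma ordinaryHypergeometric_eq_of_hasSum {a b c u S : ℂ}
    (h : HasSum (fun n : ℕ => ordinaryHypergeometricCoefficient a b c n * u ^ n) S) :
    ₂F₁ a b c u = S := by
  rw [ordinaryHypergeometric_eq_tsum]
  exact h.tsum_eq

/-- In both parts `1 ≤ k₂ ≤ k₁`. All power series that occur are also asserted to converge.
`₂F₁ a b c z` is Mathlib's `ordinaryHypergeometric`, `Complex.sqrt` the principal square root. -/
theorem mainTheorem4 (k₁ k₂ : ℕ) (hk₂ : 1 ≤ k₂) (hk : k₂ ≤ k₁) :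
    (∀ x : ℂ, x ≠ 0 → ‖x‖ < 1 →
      Summable (hypergeometric3F2Term 1 (((k₁ : ℂ) + k₂) / 2 + 1) (((k₁ : ℂ) + k₂ + 1) / 2)
        ((k₁ : ℂ) + 1) ((k₂ : ℂ) + 1) x) ∧
      hypergeometric3F2 1 (((k₁ : ℂ) + k₂) / 2 + 1) (((k₁ : ℂ) + k₂ + 1) / 2)
          ((k₁ : ℂ) + 1) ((k₂ : ℂ) + 1) x =
        ((k₁.factorial : ℂ) * (k₂.factorial : ℂ) / ((k₁ + k₂).factorial : ℂ)) *
            ((2 : ℂ) ^ (k₁ + k₂) / x ^ k₂) *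
            ((1 + Complex.sqrt (1 - x)) ^ ((k₂ : ℤ) - (k₁ : ℤ)) / Complex.sqrt (1 - x)) -
          4 * ((k₁ : ℂ) * k₂ / (((k₁ : ℂ) + k₂ - 1) * ((k₁ : ℂ) + k₂) * x)) *
            hypergeometric3F2 1 (-(k₂ : ℂ) + 1) (-(k₁ : ℂ) + 1)
              ((-(k₁ : ℂ) - k₂) / 2 + 1) ((-(k₁ : ℂ) - k₂ + 3) / 2) (1 / x)) ∧
    (∀ x : ℂ, x ≠ 1 →
      ‖1 / 2 - 1 / 2 * Complex.sqrt (1 - x)‖ < 1 → ‖1 / 2 + 1 / 2 * Complex.sqrt (1 - x)‖ < 1 →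
      (Summable fun n : ℕ => ordinaryHypergeometricCoefficient 1 ((k₁ : ℂ) + k₂) ((k₁ : ℂ) + 1) n *
        (1 / 2 - 1 / 2 * Complex.sqrt (1 - x)) ^ n) ∧
      (Summable fun n : ℕ => ordinaryHypergeometricCoefficient 1 ((k₁ : ℂ) + k₂) ((k₁ : ℂ) + 1) n *
        (1 / 2 + 1 / 2 * Complex.sqrt (1 - x)) ^ n) ∧
      hypergeometric3F2 1 (-(k₂ : ℂ) + 1) (-(k₁ : ℂ) + 1)
          ((-(k₁ : ℂ) - k₂) / 2 + 1) ((-(k₁ : ℂ) - k₂ + 3) / 2) (1 / x) =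
        -(((k₁ : ℂ) + k₂ - 1) / (4 * k₁)) * (x / Complex.sqrt (1 - x)) *
          (₂F₁ 1 ((k₁ : ℂ) + k₂) ((k₁ : ℂ) + 1) (1 / 2 - 1 / 2 * Complex.sqrt (1 - x)) -
            ₂F₁ 1 ((k₁ : ℂ) + k₂) ((k₁ : ℂ) + 1) (1 / 2 + 1 / 2 * Complex.sqrt (1 - x)))) := by

  obtain ⟨l, rfl⟩ : ∃ l, k₂ = l + 1 := ⟨k₂ - 1, by omega⟩
  obtain ⟨d, rfl⟩ : ∃ d, k₁ = l + d + 1 := ⟨k₁ - (l + 1), by omega⟩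
  have hC : ((2 * l + d).choose l : ℂ) * l.factorial * (l + d).factorial =
      (2 * l + d).factorial := by
    have := Nat.cast_choose_mul_factorial l (l + d)
    rwa [show l + (l + d) = 2 * l + d by ring] at this
  have hl : (l.factorial : ℂ) ≠ 0 := by exact_mod_cast Nat.factorial_ne_zero _
  have hld : ((l + d).factorial : ℂ) ≠ 0 := by exact_mod_cast Nat.factorial_ne_zero _
  have hC0 : ((2 * l + d).choose l : ℂ) ≠ 0 := by
    exact_mod_cast (Nat.choose_pos (by omega : l ≤ 2 * l + d)).ne'
  have hld1 : (l : ℂ) + d + 1 ≠ 0 := by exact_mod_cast (l + d).succ_ne_zero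
  have hK1 : (2 : ℂ) * l + d + 1 ≠ 0 := by exact_mod_cast (2 * l + d).succ_ne_zero
  refine ⟨fun x h0 hx => ?_, fun x h1 hu hv => ?_⟩
  · have hG := ((hasSum_nat_add_iff' (l + 1)).2
      (hasSum_choose_two_mul_add_mul_pow h0 hx d)).mul_left
        (((l + 1 + d).factorial : ℂ) * (l + 1).factorial / (l + 1 + d + (l + 1)).factorial *
          (4 / x) ^ (l + 1))
    have hterm := fun n => hypergeometric3F2Term_eq_choose (l + 1) d n ((l + d + 1 : ℕ) : ℂ)
      ((l + 1 : ℕ) : ℂ) x (by push_cast; ring) rfl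
    replace hG := hG.congr_fun (g := hypergeometric3F2Term 1
      ((((l + d + 1 : ℕ) : ℂ) + ((l + 1 : ℕ) : ℂ)) / 2 + 1)
      ((((l + d + 1 : ℕ) : ℂ) + ((l + 1 : ℕ) : ℂ) + 1) / 2)
      (((l + d + 1 : ℕ) : ℂ) + 1) (((l + 1 : ℕ) : ℂ) + 1) x) fun n => by
        rw [hterm, pow_add (x / 4), div_pow 4 x, div_pow x 4 (l + 1)]
        field_simp
    refine ⟨hG.summable, ?_⟩
    rw [hypergeometric3F2, hG.tsum_eq]
    have hT := hypergeometric3F2_terminating l d ((l + d + 1 : ℕ) : ℂ) ((l + 1 : ℕ) : ℂ) (1 / x)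
      rfl rfl
    set P := hypergeometric3F2 1 (-((l + 1 : ℕ) : ℂ) + 1) (-((l + d + 1 : ℕ) : ℂ) + 1)
      ((-((l + d + 1 : ℕ) : ℂ) - ((l + 1 : ℕ) : ℂ)) / 2 + 1)
      ((-((l + d + 1 : ℕ) : ℂ) - ((l + 1 : ℕ) : ℂ) + 3) / 2) (1 / x)
    have hR : (4 / x) ^ (l + 1) * ∑ m ∈ range (l + 1), ((2 * m + d).choose m : ℂ) * (x / 4) ^ m =
        4 / x * (((2 * l + d).choose l : ℂ) * P) := by
      rw [hT, revPowerSum, ← sum_range_reflect, mul_sum, mul_sum]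
      refine sum_congr rfl fun j hj => ?_
      obtain ⟨i, rfl⟩ : ∃ i, l = i + j := ⟨l - j, by have := mem_range.1 hj; omega⟩
      rw [show i + j + 1 - 1 - j = i by omega, Nat.add_sub_cancel, pow_succ, pow_add, div_pow,
        div_pow, div_pow, mul_pow, div_pow, one_pow]
      field_simp
    rw [mul_sub, mul_assoc _ _ (∑ m ∈ range (l + 1), _), hR]
    have hz : (((l + 1 : ℕ) : ℤ) - ((l + d + 1 : ℕ) : ℤ)) = -(d : ℤ) := by push_cast; ring
    rw [hz, zpow_neg, zpow_natCast, show l + 1 + d = l + d + 1 by ring]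
    congr 1
    · rw [div_pow, div_pow, show l + d + 1 + (l + 1) = 2 * (l + 1) + d by ring, pow_add 2, pow_mul 2]
      norm_num
      ring
    · rw [show l + d + 1 + (l + 1) = 2 * l + d + 1 + 1 by ring]
      simp only [Nat.factorial_succ]
      push_cast
      rw [← hC, show (l : ℂ) + d + 1 + (l + 1) - 1 = 2 * l + d + 1 by ring,
        show (l : ℂ) + d + 1 + (l + 1) = 2 * l + d + 2 by ring,
        show (2 : ℂ) * l + d + 1 + 1 = 2 * l + d + 2 by ring]
      field_simp
  · have hs := Complex.sqrt_mul_self (1 - x)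
    set s := Complex.sqrt (1 - x)
    have h₁ : ((l + d + 1 : ℕ) : ℂ) = ((l + d + 1 : ℕ) : ℂ) := rfl
    have hU := hasSum_ordinaryHypergeometric_one hu (l + d) l _ _ h₁ rfl
    have hV := hasSum_ordinaryHypergeometric_one hv (l + d) l _ _ h₁ rfl
    refine ⟨hU.summable, hV.summable, ?_⟩
    rw [ordinaryHypergeometric_eq_of_hasSum hU, ordinaryHypergeometric_eq_of_hasSum hV]
    have hs0 : s ≠ 0 := by
      rintro h
      rw [h, mul_zero] at hs
      exact h1 (sub_eq_zero.1 hs.symm).symm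
    have hp : 1 + s ≠ 0 := by
      rintro h
      rw [show s = -1 by linear_combination h] at hu
      norm_num at hu
    have hm : 1 - s ≠ 0 := by
      rintro h
      rw [show s = 1 by linear_combination -h] at hv
      norm_num at hv
    have hx : x = (1 - s) * (1 + s) := by linear_combination hs
    have ha : (1 - (1 / 2 - 1 / 2 * s))⁻¹ = 2 / (1 + s) := by
      rw [show 1 - (1 / 2 - 1 / 2 * s) = (1 + s) / 2 by ring, inv_div]
    have hb : (1 - (1 / 2 + 1 / 2 * s))⁻¹ = 2 / (1 - s) := by
      rw [show 1 - (1 / 2 + 1 / 2 * s) = (1 - s) / 2 by ring, inv_div]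
    have hT := hypergeometric3F2_terminating l d ((l + d + 1 : ℕ) : ℂ) ((l + 1 : ℕ) : ℂ) (1 / x)
      rfl rfl
    have hab : 2 / (1 + s) * (2 / (1 - s)) = 2 / (1 + s) + 2 / (1 - s) := by
      field_simp
      ring
    have hd := revPowerSum_diagonalChoose_sub hab d l
    have hz : 2 / (1 + s) * (2 / (1 - s)) = 4 * (1 / x) := by
      rw [hx]
      field_simp
      norm_num
    rw [hz, ← hT] at hd
    rw [ha, hb, ← mul_sub, hd]
    set P := hypergeometric3F2 1 (-((l + 1 : ℕ) : ℂ) + 1) (-((l + d + 1 : ℕ) : ℂ) + 1)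
      ((-((l + d + 1 : ℕ) : ℂ) - ((l + 1 : ℕ) : ℂ)) / 2 + 1)
      ((-((l + d + 1 : ℕ) : ℂ) - ((l + 1 : ℕ) : ℂ) + 3) / 2) (1 / x)
    rw [show l + d + 1 + l = 2 * l + d + 1 by ring, hx]
    simp only [Nat.factorial_succ]
    push_cast
    rw [← hC, show (l : ℂ) + d + 1 + (l + 1) - 1 = 2 * l + d + 1 by ring]
    field_simp
    ring
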